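/- Let $m,n\ge 1$, let $1\le p\le\infty$, and let $q$ be the conjugate exponent of $p$, i.e. $1/p+1/q=1$ with $1/\infty=0$. For a real $m\times n$ matrix $B$ let $\|B\|_{\infty\to p}$ be its operator norm as a map from $\ell_\infty^n$ to $\ell_p^m$. Let $D>0$, let $A=(a_{jk})$ be a fixed real $m\times n$ matrix, and let $X=(X_{jk})$ be a random $m\times n$ matrix whose entries are independent real random variables with $\mathbb{E}X_{jk}=a_{jk}$ and $|X_{jk}|\le D/2$ almost surely for all $j,k$. Put $s=\max\{0,\,1-2/q\}$. Then $\|A-X\|_{\infty\to p}$ is an integrable random variable and, for every $\delta>0$, $$\mathbb{P}\Big(\|A-X\|_{\infty\to p}>(1+\delta)\,\mathbb{E}\|A-X\|_{\infty\to p}\Big)\le \exp\!\left(-\frac{\delta^2\,\big(\mathbb{E}\|A-X\|_{\infty\to p}\big)^2}{4D^2\,n\,m^{s}}\right).$$ -/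

import Mathlib

open MeasureTheory ProbabilityTheory
open scoped ENNReal

/-- The `∞ → p` operator norm of a real `m × n` matrix `B`: the operator norm of `x ↦ B x` as a
continuous linear map from `ℓ_∞^n` to `ℓ_p^m`. -/
noncomputable def infToNorm (p : ℝ≥0∞) [Fact (1 ≤ p)] {m n : ℕ}
    (B : Matrix (Fin m) (Fin n) ℝ) : ℝ :=
  ‖(Matrix.toLpLin ∞ p B).toContinuousLinearMap‖

/-- The exponent `s = max {0, 1 - 2 / q}` for `q ∈ [1, ∞]`. The reciprocal is taken in the extended
nonnegative reals, so that `1 / ∞ = 0`. -/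
noncomputable def dimExponent (q : ℝ≥0∞) : ℝ :=
  max 0 (1 - 2 * (q⁻¹).toReal)

/-!
The random variable is `F (X)`, where `F B = ‖A - B‖_{∞ → p}` is convex in the matrix `B` and
Lipschitz for the Euclidean (Frobenius) norm, and the entries of `X` are independent and confined to
an interval of length `D`. The tail bound is the upper half of Talagrand's concentration inequality
for convex Lipschitz functions on a product of intervals, obtained by Maurey's infimum-convolution
method.

* *Lipschitz constant.* By Cauchy–Schwarz on the rows, `‖B x‖_2 ≤ √n ‖B‖_F ‖x‖_∞`. Comparing the
  `ℓ_p` and `ℓ_2` norms on `ℝ^m` costs a factor `m ^ max (0, 1 / p - 1 / 2) = m ^ (s / 2)`. Hence `F`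
  is `√(n m ^ s)`-Lipschitz (`infToNorm_le_sqrt`).
* *Infimum convolution.* Let `Q f x = inf_t (f t + |x - t|² / (4 D²))`. For a probability measure on
  an interval of length `D` and a convex `f`, one has `(∫ exp (Q f)) (∫ exp (-f)) ≤ 1`: moving `x`
  towards a minimizer `x₀` of `f` gives the pointwise bound
  `exp (Q f x - f x₀) ≤ 2 - exp (f x₀ - f x)`, and `a (2 - a) ≤ 1`
  (`integral_exp_mul_integral_exp_neg_le_one`). The inequality tensorizes, because the function
  obtained by infimum convolution in one coordinate followed by `log ∫ exp` over it is
  convex in the other coordinates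
  (`exists_convexOn_marginal`, `lintegral_exp_infConv_mul_lintegral_exp_neg_le_one`).
* *Concentration.* If `F` is convex and `√K`-Lipschitz, then `Q (l F) ≥ l F - l² K D²`, so the
  tensorized inequality and Jensen's inequality give `E exp (l (F - E F)) ≤ exp (l² K D²)`. The
  Chernoff bound with `l = t / (2 K D²)` yields `exp (-t² / (4 K D²))`
  (`measureReal_pi_add_integral_le_le_exp`), used with `K = n m ^ s` and `t = δ E F`.
-/

/-! ### Two elementary exponential inequalities -/

/-- After factoring out `exp (-u² / 2)` the left side is `2 cosh (u - u² / 2) exp (-u² / 2)`, and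
`cosh v ≤ exp (v² / 2)`. -/
theorem exp_sub_sq_add_exp_neg_le_two {u : ℝ} (h0 : 0 ≤ u) (h1 : u ≤ 1 / 2) :
    Real.exp (u - u ^ 2) + Real.exp (-u) ≤ 2 := by
  have hsplit : Real.exp (u - u ^ 2) + Real.exp (-u) =
      2 * (Real.cosh (u - u ^ 2 / 2) * Real.exp (-(u ^ 2 / 2))) := by
    rw [Real.cosh_eq, div_mul_eq_mul_div, add_mul, ← Real.exp_add, ← Real.exp_add]
    ring_nf
  have hsq : (u - u ^ 2 / 2) ^ 2 / 2 ≤ u ^ 2 / 2 := by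
    have : (u - u ^ 2 / 2) ^ 2 ≤ u ^ 2 :=
      pow_le_pow_left₀ (by nlinarith) (by nlinarith) 2
    linarith
  have hle : Real.cosh (u - u ^ 2 / 2) * Real.exp (-(u ^ 2 / 2)) ≤ 1 := by
    calc Real.cosh (u - u ^ 2 / 2) * Real.exp (-(u ^ 2 / 2))
        ≤ Real.exp (u ^ 2 / 2) * Real.exp (-(u ^ 2 / 2)) := by
          gcongr
          exact (Real.cosh_le_exp_half_sq _).trans (Real.exp_le_exp.2 hsq)
      _ = 1 := by rw [← Real.exp_add]; simp
  linarith

/-- The scalar inequality behind the one-dimensional case: `u` is the excess of a convex function at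
a point over its minimum, `θ` is how far the point is moved towards the minimizer, and `θ² / 4` is the
cost of the move. -/
theorem exists_exp_interpolation_add_exp_neg_le_two {u : ℝ} (h0 : 0 ≤ u) :
    ∃ θ ∈ Set.Icc (0 : ℝ) 1,
      Real.exp ((1 - θ) * u + θ ^ 2 / 4) + Real.exp (-u) ≤ 2 := by
  rcases le_total u (1 / 2) with h | h
  -- The exponent `(1 - θ) u + θ² / 4` is minimal at `θ = 2 u`, or at `θ = 1` if that exceeds `1`.
  · refine ⟨2 * u, ⟨by linarith, by linarith⟩, ?_⟩
    convert! exp_sub_sq_add_exp_neg_le_two h0 h using 3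
    ring
  · refine ⟨1, ⟨zero_le_one, le_rfl⟩, ?_⟩
    have h2 := exp_sub_sq_add_exp_neg_le_two (u := 1 / 2) (by norm_num) le_rfl
    have h3 : Real.exp (-u) ≤ Real.exp (-(1 / 2)) := Real.exp_le_exp.2 (by linarith)
    norm_num at h2 ⊢
    linarith

/-! ### Infimum convolution in one coordinate -/

section OneCoordinate

variable {E : Type*} [NormedAddCommGroup E] [NormedSpace ℝ E]

/-- Marginalizing a jointly convex function by `log ∫ exp` keeps it convex. With both integrals
normalized to `1`, this follows from the convexity of `exp` alone, without Hölder's inequality. -/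
theorem convexOn_log_integral_exp {ν : Measure ℝ} [IsProbabilityMeasure ν] {Q : ℝ × E → ℝ}
    (hQ : ConvexOn ℝ Set.univ Q) (hint : ∀ y, Integrable (fun x => Real.exp (Q (x, y))) ν) :
    ConvexOn ℝ Set.univ fun y => Real.log (∫ x, Real.exp (Q (x, y)) ∂ν) := by
  have hpos : ∀ y, 0 < ∫ x, Real.exp (Q (x, y)) ∂ν := fun y => integral_exp_pos (hint y)
  refine ⟨convex_univ, ?_⟩
  intro y _ z _ α β hα hβ hαβ
  set Iy := ∫ x, Real.exp (Q (x, y)) ∂ν with hIy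
  set Iz := ∫ x, Real.exp (Q (x, z)) ∂ν with hIz
  have hy := hpos y
  have hz := hpos z
  rw [← hIy] at hy
  rw [← hIz] at hz
  simp only [smul_eq_mul]
  rw [Real.log_le_iff_le_exp (hpos _)]
  have hpt : ∀ x, Real.exp (Q (x, α • y + β • z)) ≤ Real.exp (α * Real.log Iy + β * Real.log Iz) *
      (α * (Real.exp (Q (x, y)) / Iy) + β * (Real.exp (Q (x, z)) / Iz)) := by
    intro x
    have h1 := hQ.2 (Set.mem_univ (x, y)) (Set.mem_univ (x, z)) hα hβ hαβ
    have hx : α • (x, y) + β • (x, z) = (x, α • y + β • z) := by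
      ext <;> simp [← add_mul, hαβ]
    rw [hx] at h1
    have h2 := convexOn_exp.2 (Set.mem_univ (Q (x, y) - Real.log Iy))
      (Set.mem_univ (Q (x, z) - Real.log Iz)) hα hβ hαβ
    simp only [smul_eq_mul, Real.exp_sub, Real.exp_log hy, Real.exp_log hz] at h1 h2
    refine le_trans ?_ (mul_le_mul_of_nonneg_left h2 (Real.exp_pos _).le)
    rw [← Real.exp_add]
    exact Real.exp_le_exp.2 (by linarith)
  refine (integral_mono (hint _) ?_ hpt).trans_eq ?_
  · exact ((((hint y).div_const _).const_mul _).add (((hint z).div_const _).const_mul _)).const_mul _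
  · rw [integral_const_mul, integral_add (((hint y).div_const _).const_mul _)
      (((hint z).div_const _).const_mul _), integral_const_mul, integral_const_mul,
      integral_div, integral_div, ← hIy, ← hIz, div_self hy.ne', div_self hz.ne']
    simp [hαβ]

variable [FiniteDimensional ℝ E]

/-- The infimum convolution of `f` with `c |·|²` in the first variable, the infimum being taken over
`t ∈ [a, b]`. By compactness it is attained, and it is again jointly convex. -/
theorem exists_convexOn_partial_infConv {f : ℝ × E → ℝ} (hf : ConvexOn ℝ Set.univ f)
    {a b c : ℝ} (hab : a ≤ b) (hc : 0 ≤ c) :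
    ∃ Q : ℝ × E → ℝ, ConvexOn ℝ Set.univ Q ∧
      (∀ x y, ∀ t ∈ Set.Icc a b, Q (x, y) ≤ f (t, y) + c * (x - t) ^ 2) ∧
      ∀ x y, ∃ t ∈ Set.Icc a b, Q (x, y) = f (t, y) + c * (x - t) ^ 2 := by
  have hcont : Continuous f := by
    simpa using continuousOn_univ.1 (hf.continuousOn isOpen_univ)
  have hmin : ∀ z : ℝ × E, ∃ t ∈ Set.Icc a b,
      ∀ t' ∈ Set.Icc a b, f (t, z.2) + c * (z.1 - t) ^ 2 ≤ f (t', z.2) + c * (z.1 - t') ^ 2 := by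
    intro z
    obtain ⟨t, ht, hmin⟩ := (isCompact_Icc (a := a) (b := b)).exists_isMinOn
      (Set.nonempty_Icc.2 hab) (f := fun t => f (t, z.2) + c * (z.1 - t) ^ 2)
      (by fun_prop)
    exact ⟨t, ht, fun t' ht' => hmin ht'⟩
  choose T hT hTmin using hmin
  refine ⟨fun z => f (T z, z.2) + c * (z.1 - T z) ^ 2, ⟨convex_univ, ?_⟩,
    fun x y t ht => hTmin (x, y) t ht, fun x y => ⟨T (x, y), hT _, rfl⟩⟩
  intro z _ w _ α β hα hβ hαβ
  have hmem : α * T z + β * T w ∈ Set.Icc a b := by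
    simpa using (convex_Icc a b) (hT z) (hT w) hα hβ hαβ
  refine (hTmin _ _ hmem).trans ?_
  have h1 := hf.2 (Set.mem_univ (T z, z.2)) (Set.mem_univ (T w, w.2)) hα hβ hαβ
  have h2 := (even_two.convexOn_pow (𝕜 := ℝ)).2 (Set.mem_univ (z.1 - T z))
    (Set.mem_univ (w.1 - T w)) hα hβ hαβ
  simp only [Prod.smul_mk, Prod.mk_add_mk, smul_eq_mul, Prod.snd_add, Prod.fst_add,
    Prod.smul_fst, Prod.smul_snd] at h1 h2 ⊢
  have h3 : α * z.1 + β * w.1 - (α * T z + β * T w) = α * (z.1 - T z) + β * (w.1 - T w) := by ring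
  rw [h3]
  nlinarith [mul_le_mul_of_nonneg_left h2 hc]

theorem integrable_of_continuous_of_ae_mem_Icc {ν : Measure ℝ} [IsFiniteMeasure ν] {a b : ℝ}
    (hν : ∀ᵐ x ∂ν, x ∈ Set.Icc a b) {φ : ℝ → ℝ} (hφ : Continuous φ) : Integrable φ ν := by
  obtain ⟨C, hC⟩ := (isCompact_Icc (a := a) (b := b)).exists_bound_of_continuousOn hφ.continuousOn
  exact Integrable.of_bound hφ.aestronglyMeasurable C (hν.mono fun x hx => hC x hx)

/-- Maurey's inequality on an interval: `(∫ exp q) (∫ exp (-f)) ≤ 1` if `f` is convex and `q` is at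
most the infimum convolution of `f` with the quadratic cost `|·|² / (4 (b - a)²)`. -/
theorem integral_exp_mul_integral_exp_neg_le_one {ν : Measure ℝ} [IsProbabilityMeasure ν]
    {a b : ℝ} (hab : a < b) (hν : ∀ᵐ x ∂ν, x ∈ Set.Icc a b) {f q : ℝ → ℝ}
    (hf : ConvexOn ℝ Set.univ f) (hq : Continuous q)
    (hqf : ∀ x, ∀ t ∈ Set.Icc a b, q x ≤ f t + (4 * (b - a) ^ 2)⁻¹ * (x - t) ^ 2) :
    (∫ x, Real.exp (q x) ∂ν) * ∫ x, Real.exp (-f x) ∂ν ≤ 1 := by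
  have hcont : Continuous f := by
    simpa using continuousOn_univ.1 (hf.continuousOn isOpen_univ)
  obtain ⟨x₀, hx₀, hmin⟩ := (isCompact_Icc (a := a) (b := b)).exists_isMinOn
      (Set.nonempty_Icc.2 hab.le) hcont.continuousOn
  -- Test the infimum convolution at the point dividing the segment from `x` to the minimizer `x₀`.
  have hpt : ∀ x ∈ Set.Icc a b, Real.exp (q x - f x₀) ≤ 2 - Real.exp (f x₀ - f x) := by
    intro x hx
    have hu : 0 ≤ f x - f x₀ := sub_nonneg.2 (hmin hx)
    obtain ⟨θ, ⟨hθ0, hθ1⟩, hθ⟩ := exists_exp_interpolation_add_exp_neg_le_two hu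
    have hmem : (1 - θ) * x + θ * x₀ ∈ Set.Icc a b := by
      simpa using (convex_Icc a b) hx hx₀ (sub_nonneg.2 hθ1) hθ0 (by ring)
    have h1 := hqf x _ hmem
    have h2 := hf.2 (Set.mem_univ x) (Set.mem_univ x₀) (sub_nonneg.2 hθ1) hθ0 (by ring)
    simp only [smul_eq_mul] at h2
    have h3 : (x - x₀) ^ 2 ≤ (b - a) ^ 2 := by
      refine sq_le_sq' ?_ ?_ <;> linarith [hx.1, hx.2, hx₀.1, hx₀.2]
    have hba : 0 < (b - a) ^ 2 := by have := sub_pos.2 hab; positivity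
    have h4 : (4 * (b - a) ^ 2)⁻¹ * (x - ((1 - θ) * x + θ * x₀)) ^ 2 ≤ θ ^ 2 / 4 := by
      rw [inv_mul_le_iff₀ (by positivity)]
      nlinarith [mul_le_mul_of_nonneg_left h3 (sq_nonneg θ)]
    have h5 : Real.exp (q x - f x₀) ≤ Real.exp ((1 - θ) * (f x - f x₀) + θ ^ 2 / 4) :=
      Real.exp_le_exp.2 (by linarith)
    rw [neg_sub] at hθ
    linarith
  have hi1 : Integrable (fun x => Real.exp (q x - f x₀)) ν :=
    integrable_of_continuous_of_ae_mem_Icc hν (by fun_prop)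
  have hi2 : Integrable (fun x => Real.exp (f x₀ - f x)) ν :=
    integrable_of_continuous_of_ae_mem_Icc hν (by fun_prop)
  have hle : ∫ x, Real.exp (q x - f x₀) ∂ν ≤ 2 - ∫ x, Real.exp (f x₀ - f x) ∂ν := by
    have := integral_mono_ae hi1 ((integrable_const 2).sub hi2) (hν.mono hpt)
    simpa [integral_sub (integrable_const (2 : ℝ)) hi2] using this
  have hnn : 0 ≤ ∫ x, Real.exp (f x₀ - f x) ∂ν := integral_nonneg fun x => (Real.exp_pos _).le
  -- Subtracting the constant `f x₀` from both `q` and `f` does not change the product.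
  have hprod : (∫ x, Real.exp (q x) ∂ν) * ∫ x, Real.exp (-f x) ∂ν =
      (∫ x, Real.exp (q x - f x₀) ∂ν) * ∫ x, Real.exp (f x₀ - f x) ∂ν := by
    simp_rw [sub_eq_add_neg, Real.exp_add, integral_mul_const, integral_const_mul]
    rw [mul_assoc, ← mul_assoc (Real.exp (-f x₀)), ← Real.exp_add]
    simp
  rw [hprod]
  -- With `a = ∫ exp (f x₀ - f)`, the product is at most `(2 - a) a = 1 - (1 - a)²`.
  nlinarith [sq_nonneg (1 - ∫ x, Real.exp (f x₀ - f x) ∂ν)]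

/-- The induction step of the tensorization. The convex function `g` is `log ∫ exp` of the infimum
convolution of `f` in the first variable. Integrating out this variable turns `exp (-f)` into a
function dominated by `exp (-g)`, and a function bounded by `f` plus the quadratic cost into one
bounded by `g`, the constant `r` standing for the cost in the remaining variables. -/
theorem exists_convexOn_marginal {ν : Measure ℝ} [IsProbabilityMeasure ν] {a b : ℝ}
    (hab : a < b) (hν : ∀ᵐ x ∂ν, x ∈ Set.Icc a b) {f : ℝ × E → ℝ} (hf : ConvexOn ℝ Set.univ f) :
    ∃ g : E → ℝ, ConvexOn ℝ Set.univ g ∧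
      (∀ y, ∫⁻ x, ENNReal.ofReal (Real.exp (-f (x, y))) ∂ν ≤ ENNReal.ofReal (Real.exp (-g y))) ∧
      ∀ (w : ℝ → ℝ≥0∞) (y : E) (r : ℝ),
        (∀ x t, w x ≤
          ENNReal.ofReal (Real.exp (f (t, y) + (4 * (b - a) ^ 2)⁻¹ * (x - t) ^ 2 + r))) →
        ∫⁻ x, w x ∂ν ≤ ENNReal.ofReal (Real.exp (g y + r)) := by
  obtain ⟨Q, hQ, hQle, hQeq⟩ := exists_convexOn_partial_infConv hf hab.le
    (c := (4 * (b - a) ^ 2)⁻¹) (by positivity)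
  have hQc : Continuous Q := continuousOn_univ.1 (hQ.continuousOn isOpen_univ)
  have hfc : Continuous f := continuousOn_univ.1 (hf.continuousOn isOpen_univ)
  have hint : ∀ y, Integrable (fun x => Real.exp (Q (x, y))) ν := fun y =>
    integrable_of_continuous_of_ae_mem_Icc hν (by fun_prop)
  have hpos : ∀ y, 0 < ∫ x, Real.exp (Q (x, y)) ∂ν := fun y => integral_exp_pos (hint y)
  refine ⟨fun y => Real.log (∫ x, Real.exp (Q (x, y)) ∂ν), convexOn_log_integral_exp hQ hint,
    fun y => ?_, fun w y r hw => ?_⟩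
  · have hslice : ConvexOn ℝ Set.univ fun x => f (x, y) := by
      refine ⟨convex_univ, fun x _ t _ α β hα hβ hαβ => ?_⟩
      have h1 := hf.2 (Set.mem_univ (x, y)) (Set.mem_univ (t, y)) hα hβ hαβ
      have hx : α • (x, y) + β • (t, y) = (α • x + β • t, y) := by
        ext <;> simp [← add_smul, hαβ]
      rwa [hx] at h1
    have hle := integral_exp_mul_integral_exp_neg_le_one hab hν hslice
      (q := fun x => Q (x, y)) (by fun_prop) (fun x t ht => hQle x y t ht)
    rw [← ofReal_integral_eq_lintegral_ofReal
      (integrable_of_continuous_of_ae_mem_Icc hν (by fun_prop))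
      (ae_of_all _ fun x => (Real.exp_pos _).le)]
    refine ENNReal.ofReal_le_ofReal ?_
    rw [Real.exp_neg, Real.exp_log (hpos y), ← one_div, le_div_iff₀' (hpos y)]
    exact hle
  · rw [Real.exp_add, Real.exp_log (hpos y), ← integral_mul_const,
      ofReal_integral_eq_lintegral_ofReal ((hint y).mul_const _)
        (ae_of_all _ fun x => by positivity)]
    refine lintegral_mono fun x => ?_
    obtain ⟨t, -, ht⟩ := hQeq x y
    rw [← Real.exp_add, ht]
    exact hw x t

end OneCoordinate

/-! ### Tensorization -/

/-- Maurey's inequality on a product of intervals. The function `u` plays the role of the exponential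
of the infimum convolution of `f`. Allowing any measurable `u` below it, with values in `ℝ≥0∞`, avoids
questions of measurability and integrability for the infimum convolution itself. -/
theorem lintegral_exp_infConv_mul_lintegral_exp_neg_le_one {a b : ℝ} (hab : a < b) {N : ℕ}
    (ν : Fin N → Measure ℝ) [∀ i, IsProbabilityMeasure (ν i)]
    (hν : ∀ i, ∀ᵐ x ∂ν i, x ∈ Set.Icc a b)
    {f : (Fin N → ℝ) → ℝ} (hf : ConvexOn ℝ Set.univ f) {u : (Fin N → ℝ) → ℝ≥0∞}
    (hu : Measurable u)
    (huf : ∀ x t, u x ≤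
      ENNReal.ofReal (Real.exp (f t + (4 * (b - a) ^ 2)⁻¹ * ∑ i, (x i - t i) ^ 2))) :
    (∫⁻ x, u x ∂Measure.pi ν) * ∫⁻ x, ENNReal.ofReal (Real.exp (-f x)) ∂Measure.pi ν ≤ 1 := by
  induction N with
  | zero =>
    rw [Measure.pi_of_empty, lintegral_dirac, lintegral_dirac]
    refine (mul_le_mul_left (huf _ fun i => isEmptyElim i) _).trans ?_
    rw [← ENNReal.ofReal_mul (Real.exp_pos _).le, ← Real.exp_add]
    simp
  | succ N ih =>
    have hfc : Continuous f := continuousOn_univ.1 (hf.continuousOn isOpen_univ)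
    have hfubini : ∀ w : (Fin (N + 1) → ℝ) → ℝ≥0∞, Measurable w → ∫⁻ x, w x ∂Measure.pi ν =
        ∫⁻ y, ∫⁻ x, w (Fin.consLinearEquiv ℝ (fun _ => ℝ) (x, y)) ∂ν 0
          ∂Measure.pi fun j : Fin N => ν j.succ := by
      intro w hw
      have hmp := (measurePreserving_piFinSuccAbove ν 0).symm
      rw [← hmp.lintegral_comp hw]
      refine (lintegral_prod_symm (μ := ν 0) (ν := Measure.pi fun j : Fin N => ν j.succ)
        _ (hw.comp hmp.measurable).aemeasurable).trans ?_
      refine lintegral_congr fun y => lintegral_congr fun x => congrArg w ?_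
      exact Fin.insertNth_zero' x y
    have hmeas : Measurable fun z : ℝ × (Fin N → ℝ) =>
        Fin.consLinearEquiv ℝ (fun _ : Fin (N + 1) => ℝ) z :=
      (LinearMap.continuous_of_finiteDimensional
        (Fin.consLinearEquiv ℝ (fun _ : Fin (N + 1) => ℝ)).toLinearMap).measurable
    have hF : ConvexOn ℝ Set.univ fun z : ℝ × (Fin N → ℝ) =>
        f (Fin.consLinearEquiv ℝ (fun _ : Fin (N + 1) => ℝ) z) :=
      hf.comp_linearMap (Fin.consLinearEquiv ℝ (fun _ : Fin (N + 1) => ℝ)).toLinearMap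
    obtain ⟨g, hg, hgf, hgw⟩ := exists_convexOn_marginal hab (hν 0) hF
    rw [hfubini u hu, hfubini _ (by fun_prop)]
    refine (mul_le_mul_right (lintegral_mono hgf) _).trans ?_
    refine ih (fun j => ν j.succ) (fun j => hν j.succ) hg
      (hu.comp hmeas).lintegral_prod_left' fun y s => ?_
    refine hgw _ s _ fun x t => (huf _ (Fin.consLinearEquiv ℝ (fun _ => ℝ) (t, s))).trans_eq ?_
    rw [Fin.sum_univ_succ]
    simp [mul_add, add_assoc]

/-! ### Concentration of convex Lipschitz functions under a product measure -/

theorem ae_pi_mem_Icc {a b : ℝ} {N : ℕ} (ν : Fin N → Measure ℝ) [∀ i, IsProbabilityMeasure (ν i)]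
    (hν : ∀ i, ∀ᵐ x ∂ν i, x ∈ Set.Icc a b) :
    ∀ᵐ x ∂Measure.pi ν, x ∈ Set.Icc (fun _ : Fin N => a) fun _ => b := by
  have h : ∀ᵐ x ∂Measure.pi ν, ∀ i, x i ∈ Set.Icc a b :=
    ae_all_iff.2 fun i => (measurePreserving_eval ν i).quasiMeasurePreserving.ae (hν i)
  filter_upwards [h] with x hx
  exact ⟨fun i => (hx i).1, fun i => (hx i).2⟩

theorem integrable_pi_of_continuous {a b : ℝ} {N : ℕ} (ν : Fin N → Measure ℝ)
    [∀ i, IsProbabilityMeasure (ν i)] (hν : ∀ i, ∀ᵐ x ∂ν i, x ∈ Set.Icc a b)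
    {φ : (Fin N → ℝ) → ℝ} (hφ : Continuous φ) : Integrable φ (Measure.pi ν) := by
  obtain ⟨C, hC⟩ := (isCompact_Icc (a := fun _ : Fin N => a)
    (b := fun _ => b)).exists_bound_of_continuousOn hφ.continuousOn
  exact Integrable.of_bound hφ.aestronglyMeasurable C ((ae_pi_mem_Icc ν hν).mono fun x hx => hC x hx)

/-- The exponential moment bound `E exp (l (F - E F)) ≤ exp (l² K (b - a)²)` for a convex,
`√K`-Lipschitz function of independent coordinates in `[a, b]`. -/
theorem lintegral_exp_sub_integral_le_one {a b : ℝ} (hab : a < b) {N : ℕ}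
    (ν : Fin N → Measure ℝ) [∀ i, IsProbabilityMeasure (ν i)]
    (hν : ∀ i, ∀ᵐ x ∂ν i, x ∈ Set.Icc a b) {F : (Fin N → ℝ) → ℝ} (hF : ConvexOn ℝ Set.univ F)
    {K : ℝ} (hK : 0 ≤ K) (hFK : ∀ x y, F x ≤ F y + √(K * ∑ i, (x i - y i) ^ 2))
    {l : ℝ} (hl : 0 ≤ l) :
    ∫⁻ x, ENNReal.ofReal (Real.exp (l * (F x - ∫ y, F y ∂Measure.pi ν) - l ^ 2 * K * (b - a) ^ 2))
      ∂Measure.pi ν ≤ 1 := by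
  have hFc : Continuous F := continuousOn_univ.1 (hF.continuousOn isOpen_univ)
  have hFi := integrable_pi_of_continuous ν hν hFc
  set M := ∫ y, F y ∂Measure.pi ν with hM
  have hconv : ConvexOn ℝ Set.univ fun x => l * (F x - M) :=
    (hF.add_const (-M)).smul hl
  have hba : 0 < b - a := sub_pos.2 hab
  have htau := lintegral_exp_infConv_mul_lintegral_exp_neg_le_one hab ν hν hconv
    (u := fun x => ENNReal.ofReal (Real.exp (l * (F x - M) - l ^ 2 * K * (b - a) ^ 2)))
    (by fun_prop) (by
      intro x t
      refine ENNReal.ofReal_le_ofReal (Real.exp_le_exp.2 ?_)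
      have hS : 0 ≤ ∑ i, (x i - t i) ^ 2 := Finset.sum_nonneg fun i _ => sq_nonneg _
      have h1 := mul_le_mul_of_nonneg_left (hFK x t) hl
      rw [Real.sqrt_mul hK] at h1
      -- With `d` the distance, `l √K d ≤ l² K (b - a)² + d² / (4 (b - a)²)`: complete the square.
      have h2 := sq_nonneg (l * √K * (b - a) - (2 * (b - a))⁻¹ * √(∑ i, (x i - t i) ^ 2))
      have h3 : (l * √K * (b - a) - (2 * (b - a))⁻¹ * √(∑ i, (x i - t i) ^ 2)) ^ 2 =
          l ^ 2 * K * (b - a) ^ 2 - l * (√K * √(∑ i, (x i - t i) ^ 2)) +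
            (4 * (b - a) ^ 2)⁻¹ * ∑ i, (x i - t i) ^ 2 := by
        rw [sub_sq, mul_pow, mul_pow, mul_pow, Real.sq_sqrt hK, Real.sq_sqrt hS]
        field_simp
        ring
      linarith)
  have hjensen : 1 ≤ ∫⁻ x, ENNReal.ofReal (Real.exp (-(l * (F x - M)))) ∂Measure.pi ν := by
    rw [← ofReal_integral_eq_lintegral_ofReal (integrable_pi_of_continuous ν hν (by fun_prop))
      (ae_of_all _ fun x => (Real.exp_pos _).le), ENNReal.one_le_ofReal]
    calc (1 : ℝ) = ∫ x, (1 - l * (F x - M)) ∂Measure.pi ν := by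
          have hi : Integrable (fun x => F x - M) (Measure.pi ν) := hFi.sub (integrable_const _)
          rw [integral_sub (integrable_const _) (hi.const_mul _), integral_const_mul,
            integral_sub hFi (integrable_const _)]
          simp [hM]
      _ ≤ _ := integral_mono (integrable_pi_of_continuous ν hν (by fun_prop))
          (integrable_pi_of_continuous ν hν (by fun_prop)) fun x => by
            have := Real.add_one_le_exp (-(l * (F x - M)))
            dsimp only
            linarith
  exact (le_mul_of_one_le_right' hjensen).trans htau

/-- Upper tail of a convex, `√K`-Lipschitz function of independent coordinates in `[a, b]`: the
Chernoff bound for the exponential moments of `lintegral_exp_sub_integral_le_one`. -/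
theorem measureReal_pi_add_integral_le_le_exp {a b : ℝ} (hab : a < b) {N : ℕ}
    (ν : Fin N → Measure ℝ) [∀ i, IsProbabilityMeasure (ν i)]
    (hν : ∀ i, ∀ᵐ x ∂ν i, x ∈ Set.Icc a b) {F : (Fin N → ℝ) → ℝ} (hF : ConvexOn ℝ Set.univ F)
    {K : ℝ} (hK : 0 < K) (hFK : ∀ x y, F x ≤ F y + √(K * ∑ i, (x i - y i) ^ 2))
    {t : ℝ} (ht : 0 ≤ t) :
    (Measure.pi ν).real {x | (∫ y, F y ∂Measure.pi ν) + t ≤ F x} ≤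
      Real.exp (-t ^ 2 / (4 * (b - a) ^ 2 * K)) := by
  have hFc : Continuous F := continuousOn_univ.1 (hF.continuousOn isOpen_univ)
  have hba : 0 < b - a := sub_pos.2 hab
  -- The value of `l` minimizing `-l t + l² K (b - a)²`.
  set l := t / (2 * K * (b - a) ^ 2) with hl
  have hl0 : 0 ≤ l := by positivity
  have hmgf := lintegral_exp_sub_integral_le_one hab ν hν hF hK.le hFK hl0
  set M := ∫ y, F y ∂Measure.pi ν
  have hexp : l * t - l ^ 2 * K * (b - a) ^ 2 = t ^ 2 / (4 * (b - a) ^ 2 * K) := by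
    rw [hl]
    field_simp
    ring
  have hmarkov := mul_meas_ge_le_lintegral (μ := Measure.pi ν)
    (f := fun x => ENNReal.ofReal (Real.exp (l * (F x - M) - l ^ 2 * K * (b - a) ^ 2)))
    (by fun_prop) (ENNReal.ofReal (Real.exp (t ^ 2 / (4 * (b - a) ^ 2 * K))))
  have hsub : {x | M + t ≤ F x} ⊆ {x | ENNReal.ofReal (Real.exp (t ^ 2 / (4 * (b - a) ^ 2 * K))) ≤
      ENNReal.ofReal (Real.exp (l * (F x - M) - l ^ 2 * K * (b - a) ^ 2))} := by
    intro x hx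
    refine ENNReal.ofReal_le_ofReal (Real.exp_le_exp.2 ?_)
    rw [← hexp]
    have := mul_le_mul_of_nonneg_left (show t ≤ F x - M from le_sub_iff_add_le'.2 hx) hl0
    linarith
  have hle := (mul_le_mul_right (measure_mono hsub) _).trans (hmarkov.trans hmgf)
  have hreal := ENNReal.toReal_mono ENNReal.one_ne_top hle
  rw [ENNReal.toReal_mul, ENNReal.toReal_ofReal (Real.exp_pos _).le, ENNReal.toReal_one] at hreal
  rw [neg_div, Real.exp_neg, ← one_div, le_div_iff₀' (Real.exp_pos _)]
  exact hreal

/-! ### The operator norm as a convex Lipschitz function of the entries -/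

theorem infToNorm_add_le (p : ℝ≥0∞) [Fact (1 ≤ p)] {m n : ℕ} (B C : Matrix (Fin m) (Fin n) ℝ) :
    infToNorm p (B + C) ≤ infToNorm p B + infToNorm p C := by
  unfold infToNorm
  rw [map_add, map_add]
  exact norm_add_le _ _

theorem infToNorm_smul (p : ℝ≥0∞) [Fact (1 ≤ p)] {m n : ℕ} (c : ℝ)
    (B : Matrix (Fin m) (Fin n) ℝ) : infToNorm p (c • B) = |c| * infToNorm p B := by
  unfold infToNorm
  rw [map_smul, map_smul, norm_smul, Real.norm_eq_abs]

theorem convexOn_infToNorm (p : ℝ≥0∞) [Fact (1 ≤ p)] {m n : ℕ} :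
    ConvexOn ℝ Set.univ (infToNorm p : Matrix (Fin m) (Fin n) ℝ → ℝ) := by
  refine ⟨convex_univ, fun B _ C _ α β hα hβ _ => (infToNorm_add_le p _ _).trans_eq ?_⟩
  rw [infToNorm_smul, infToNorm_smul, abs_of_nonneg hα, abs_of_nonneg hβ]
  rfl

/-- For `r ≥ 2` the `ℓ_r` norm is at most the `ℓ_2` norm, in squared form. -/
theorem sum_rpow_rpow_le_sum_sq {m : ℕ} (v : Fin m → ℝ) {r : ℝ} (hr : 2 ≤ r) :
    (∑ i, |v i| ^ r) ^ (2 / r) ≤ ∑ i, v i ^ 2 := by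
  set S := ∑ i, v i ^ 2 with hS
  have hS0 : 0 ≤ S := Finset.sum_nonneg fun i _ => sq_nonneg _
  have hr0 : 0 < r := by linarith
  have hterm : ∀ i, |v i| ^ r ≤ v i ^ 2 * S ^ ((r - 2) / 2) := by
    intro i
    have h1 : v i ^ 2 ≤ S :=
      Finset.single_le_sum (f := fun i => v i ^ 2) (fun i _ => sq_nonneg _) (Finset.mem_univ i)
    have h2 : |v i| ^ r = |v i| ^ (2 : ℝ) * |v i| ^ (r - 2) := by
      rw [← Real.rpow_add_of_nonneg (abs_nonneg _) zero_le_two (by linarith)]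
      ring_nf
    have h3 : |v i| ^ (r - 2) = (v i ^ 2) ^ ((r - 2) / 2) := by
      rw [← sq_abs, ← Real.rpow_natCast, ← Real.rpow_mul (abs_nonneg _)]
      congr 1
      push_cast
      ring
    rw [h2, h3, Real.rpow_two, sq_abs]
    gcongr
  have hsum : ∑ i, |v i| ^ r ≤ S ^ (r / 2) := by
    calc ∑ i, |v i| ^ r ≤ ∑ i, v i ^ 2 * S ^ ((r - 2) / 2) := Finset.sum_le_sum fun i _ => hterm i
      _ = S ^ (1 : ℝ) * S ^ ((r - 2) / 2) := by rw [← Finset.sum_mul, Real.rpow_one]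
      _ = S ^ (r / 2) := by
        rw [← Real.rpow_add_of_nonneg hS0 zero_le_one (by linarith)]
        ring_nf
  calc (∑ i, |v i| ^ r) ^ (2 / r) ≤ (S ^ (r / 2)) ^ (2 / r) := by
        gcongr
    _ = S := by
        rw [← Real.rpow_mul hS0, show r / 2 * (2 / r) = 1 by field_simp, Real.rpow_one]

/-- For `r ≤ 2` the power mean inequality bounds the `ℓ_r` norm by the `ℓ_2` norm, in squared form. -/
theorem sum_rpow_rpow_le_card_rpow_mul_sum_sq {m : ℕ} (v : Fin m → ℝ) {r : ℝ} (hr0 : 0 < r)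
    (hr : r ≤ 2) :
    (∑ i, |v i| ^ r) ^ (2 / r) ≤ (m : ℝ) ^ (2 / r - 1) * ∑ i, v i ^ 2 := by
  have h := Real.rpow_sum_le_const_mul_sum_rpow_of_nonneg (Finset.univ : Finset (Fin m))
    (f := fun i => |v i| ^ r) (p := 2 / r) ((one_le_div hr0).2 hr)
    (fun i _ => Real.rpow_nonneg (abs_nonneg _) _)
  refine h.trans_eq ?_
  rw [Finset.card_univ, Fintype.card_fin]
  congr 1
  refine Finset.sum_congr rfl fun i _ => ?_
  rw [← Real.rpow_mul (abs_nonneg _), show r * (2 / r) = 2 by field_simp, Real.rpow_two, sq_abs]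

theorem dimExponent_eq (p q : ℝ≥0∞) [Fact (1 ≤ p)] [ENNReal.HolderConjugate p q] :
    dimExponent q = max 0 (2 * (p⁻¹).toReal - 1) := by
  have hp : p⁻¹ ≠ ∞ := ENNReal.inv_ne_top.2 (ENNReal.HolderConjugate.ne_zero p q)
  have hq : q⁻¹ ≠ ∞ := ENNReal.inv_ne_top.2 (ENNReal.HolderConjugate.ne_zero q p)
  have h := congrArg ENNReal.toReal (ENNReal.HolderConjugate.inv_add_inv_eq_one p q)
  rw [ENNReal.toReal_add hp hq, ENNReal.toReal_one] at h
  unfold dimExponent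
  congr 1
  linarith

/-- Comparison of the `ℓ_p` and `ℓ_2` norms on `ℝ^m`, in squared form. The exponent of `m` is
`max (0, 2 / p - 1)`, which is `dimExponent q` for the conjugate exponent `q`. -/
theorem norm_toLp_sq_le (p q : ℝ≥0∞) [Fact (1 ≤ p)] [ENNReal.HolderConjugate p q] {m : ℕ}
    (v : Fin m → ℝ) :
    ‖WithLp.toLp p v‖ ^ 2 ≤ (m : ℝ) ^ dimExponent q * ∑ i, v i ^ 2 := by
  have hp1 : 1 ≤ p := Fact.out
  have hS0 : 0 ≤ ∑ i, v i ^ 2 := Finset.sum_nonneg fun i _ => sq_nonneg _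
  rcases Nat.eq_zero_or_pos m with rfl | hm
  · simp [Subsingleton.elim (WithLp.toLp p v) 0]
  have hm1 : (1 : ℝ) ≤ m := by exact_mod_cast hm
  have hdim := dimExponent_eq p q
  have hone : (1 : ℝ) ≤ (m : ℝ) ^ dimExponent q := by
    refine Real.one_le_rpow hm1 ?_
    rw [hdim]
    exact le_max_left _ _
  by_cases hp : p = ∞
  · subst hp
    refine le_trans ?_ (le_mul_of_one_le_left hS0 hone)
    have hle : ‖WithLp.toLp ∞ v‖ ≤ √(∑ i, v i ^ 2) := by
      rw [PiLp.norm_eq_ciSup]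
      refine Real.iSup_le (fun i => Real.le_sqrt_of_sq_le ?_) (Real.sqrt_nonneg _)
      rw [Real.norm_eq_abs, sq_abs]
      exact Finset.single_le_sum (f := fun i => v i ^ 2) (fun i _ => sq_nonneg _)
        (Finset.mem_univ i)
    exact (Real.le_sqrt (norm_nonneg _) hS0).1 hle
  · have hr1 : 1 ≤ p.toReal := by
      simpa using ENNReal.toReal_mono hp hp1
    have hr0 : 0 < p.toReal := by linarith
    have hnorm : ‖WithLp.toLp p v‖ ^ 2 = (∑ i, |v i| ^ p.toReal) ^ (2 / p.toReal) := by
      rw [PiLp.norm_eq_sum hr0, ← Real.rpow_natCast, ← Real.rpow_mul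
        (Finset.sum_nonneg fun i _ => Real.rpow_nonneg (norm_nonneg _) _)]
      simp only [Real.norm_eq_abs]
      congr 1
      push_cast
      ring
    rw [hnorm]
    rcases le_total 2 p.toReal with h | h
    · exact (sum_rpow_rpow_le_sum_sq v h).trans (le_mul_of_one_le_left hS0 hone)
    · refine (sum_rpow_rpow_le_card_rpow_mul_sum_sq v hr0 h).trans ?_
      gcongr
      rw [hdim, ENNReal.toReal_inv, ← div_eq_mul_inv]
      exact le_max_right _ _

/-- The `∞ → p` operator norm is at most `√(n m ^ s)` times the Frobenius norm. -/
theorem infToNorm_le_sqrt (p q : ℝ≥0∞) [Fact (1 ≤ p)] [ENNReal.HolderConjugate p q] {m n : ℕ}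
    (B : Matrix (Fin m) (Fin n) ℝ) :
    infToNorm p B ≤ √((n : ℝ) * (m : ℝ) ^ dimExponent q * ∑ j, ∑ k, B j k ^ 2) := by
  refine ContinuousLinearMap.opNorm_le_bound _ (Real.sqrt_nonneg _) fun x => ?_
  have hx : ∀ k, x k ^ 2 ≤ ‖x‖ ^ 2 := by
    intro k
    rw [← sq_abs]
    gcongr
    exact PiLp.norm_apply_le x k
  -- Cauchy–Schwarz on each row, with `∑ x_k² ≤ n ‖x‖_∞²`.
  have hrow : ∀ j, (B.mulVec (WithLp.ofLp x) j) ^ 2 ≤ (∑ k, B j k ^ 2) * (n * ‖x‖ ^ 2) := by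
    intro j
    refine (Finset.sum_mul_sq_le_sq_mul_sq Finset.univ (B j) fun k => x k).trans ?_
    gcongr
    simpa using Finset.sum_le_sum fun k (_ : k ∈ Finset.univ) => hx k
  refine (sq_le_sq₀ (norm_nonneg _) (by positivity)).1 ?_
  rw [mul_pow, Real.sq_sqrt (by positivity)]
  refine (norm_toLp_sq_le p q (B.mulVec (WithLp.ofLp x))).trans ?_
  calc (m : ℝ) ^ dimExponent q * ∑ j, (B.mulVec (WithLp.ofLp x) j) ^ 2
      ≤ (m : ℝ) ^ dimExponent q * ∑ j, (∑ k, B j k ^ 2) * (n * ‖x‖ ^ 2) := by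
        gcongr with j
        exact hrow j
    _ = _ := by rw [← Finset.sum_mul]; ring

/-! ### Concentration of the operator norm -/

theorem corollary4p6 {Ω : Type*} [MeasurableSpace Ω] (μ : Measure Ω) [IsProbabilityMeasure μ]
    (m n : ℕ) (p q : ℝ≥0∞) [Fact (1 ≤ p)] [ENNReal.HolderConjugate p q]
    (A : Matrix (Fin m) (Fin n) ℝ) (X : Ω → Matrix (Fin m) (Fin n) ℝ) (D : ℝ)
    (hmeas : ∀ j k, Measurable fun ω => X ω j k)
    (hindep : iIndepFun (fun (jk : Fin m × Fin n) (ω : Ω) => X ω jk.1 jk.2) μ)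
    (hmean : ∀ j k, ∫ ω, X ω j k ∂μ = A j k)
    (hbound : ∀ j k, ∀ᵐ ω ∂μ, |X ω j k| ≤ D / 2) :
    Integrable (fun ω => infToNorm p (A - X ω)) μ ∧
      ∀ δ : ℝ, 0 < δ →
        μ.real {ω | infToNorm p (A - X ω) > (1 + δ) * ∫ ω', infToNorm p (A - X ω') ∂μ} ≤
          Real.exp (-(δ ^ 2 * (∫ ω, infToNorm p (A - X ω) ∂μ) ^ 2) /
            (4 * D ^ 2 * (n : ℝ) * (m : ℝ) ^ dimExponent q)) := by
  -- List the entries of `X` as a vector `Y` indexed by `Fin (m * n)`, whose law is a product measure.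
  set e : Fin m × Fin n ≃ Fin (m * n) := finProdFinEquiv
  set Y : Fin (m * n) → Ω → ℝ := fun i ω => X ω (e.symm i).1 (e.symm i).2 with hY
  have hYmeas : ∀ i, Measurable (Y i) := fun i => hmeas _ _
  have hYlaw : μ.map (fun ω i => Y i ω) = Measure.pi fun i => μ.map (Y i) :=
    (iIndepFun_iff_map_fun_eq_pi_map fun i => (hYmeas i).aemeasurable).1
      (hindep.precomp e.symm.injective)
  have hYvec : Measurable fun ω i => Y i ω := measurable_pi_iff.2 hYmeas
  have : ∀ i, IsProbabilityMeasure (μ.map (Y i)) := fun i =>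
    Measure.isProbabilityMeasure_map (hYmeas i).aemeasurable
  set F : (Fin (m * n) → ℝ) → ℝ := fun x => infToNorm p (A - Matrix.of fun j k => x (e (j, k)))
    with hF
  have hFX : ∀ ω, infToNorm p (A - X ω) = F fun i => Y i ω := by
    intro ω
    simp only [hF, hY, Equiv.symm_apply_apply]
    rfl
  have hFconv : ConvexOn ℝ Set.univ F := by
    refine ⟨convex_univ, fun x _ y _ α β hα hβ hαβ => ?_⟩
    have h := (convexOn_infToNorm p).2 (Set.mem_univ (A - Matrix.of fun j k => x (e (j, k))))
      (Set.mem_univ (A - Matrix.of fun j k => y (e (j, k)))) hα hβ hαβ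
    refine le_of_eq_of_le ?_ h
    simp only [hF]
    congr 1
    ext j k
    simp only [Matrix.sub_apply, Matrix.add_apply, Matrix.smul_apply, Matrix.of_apply,
      Pi.add_apply, Pi.smul_apply, smul_eq_mul]
    linear_combination (-A j k) * hαβ
  have hFcont : Continuous F := continuousOn_univ.1 (hFconv.continuousOn isOpen_univ)
  -- Working with `|D|` spares a case split on the sign of `D`, which can be negative only if there
  -- are no entries.
  have hYbound : ∀ i, ∀ᵐ x ∂μ.map (Y i), x ∈ Set.Icc (-(|D| / 2)) (|D| / 2) := by
    intro i
    refine (ae_map_iff (hYmeas i).aemeasurable measurableSet_Icc).2 ?_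
    filter_upwards [hbound (e.symm i).1 (e.symm i).2] with ω hω
    exact abs_le.1 (hω.trans (by linarith [le_abs_self D]))
  have hFint : Integrable F (Measure.pi fun i => μ.map (Y i)) :=
    integrable_pi_of_continuous _ hYbound hFcont
  have hint : Integrable (fun ω => infToNorm p (A - X ω)) μ := by
    simp_rw [hFX]
    rw [← hYlaw] at hFint
    exact hFint.comp_measurable hYvec
  have hmeanF : ∫ ω, infToNorm p (A - X ω) ∂μ = ∫ x, F x ∂Measure.pi fun i => μ.map (Y i) := by
    simp_rw [hFX]
    rw [← hYlaw, integral_map hYvec.aemeasurable hFcont.aestronglyMeasurable]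
  refine ⟨hint, fun δ hδ => ?_⟩
  have hE0 : 0 ≤ ∫ ω, infToNorm p (A - X ω) ∂μ := integral_nonneg fun ω => norm_nonneg _
  set M := ∫ ω, infToNorm p (A - X ω) ∂μ
  -- The denominator vanishes if `D = 0` or `n = 0`, or if `m = 0 < s`. The quotient is then `0` by
  -- convention, and the bound reads `≤ 1`.
  rcases eq_or_ne (4 * D ^ 2 * (n : ℝ) * (m : ℝ) ^ dimExponent q) 0 with h0 | h0
  · rw [h0, div_zero, Real.exp_zero]
    exact measureReal_le_one
  have hD : D ≠ 0 := by rintro rfl; simp at h0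
  have hK : 0 < (n : ℝ) * (m : ℝ) ^ dimExponent q := by
    refine lt_of_le_of_ne (by positivity) fun h => h0 ?_
    rw [mul_assoc, ← h, mul_zero]
  have hlip : ∀ x y, F x ≤ F y +
      √((n : ℝ) * (m : ℝ) ^ dimExponent q * ∑ i, (x i - y i) ^ 2) := by
    intro x y
    have h := infToNorm_add_le p (A - Matrix.of fun j k => y (e (j, k)))
      (Matrix.of fun j k => y (e (j, k)) - x (e (j, k)))
    have hxy : (A - Matrix.of fun j k => y (e (j, k))) +
        (Matrix.of fun j k => y (e (j, k)) - x (e (j, k))) =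
        A - Matrix.of fun j k => x (e (j, k)) := by
      ext j k
      simp
    rw [hxy] at h
    refine h.trans (add_le_add_right ((infToNorm_le_sqrt p q _).trans_eq ?_) _)
    congr 2
    rw [← e.sum_comp, Fintype.sum_prod_type]
    refine Finset.sum_congr rfl fun j _ => Finset.sum_congr rfl fun k _ => ?_
    rw [Matrix.of_apply]
    ring
  have hDpos : 0 < |D| := abs_pos.2 hD
  have hconc := measureReal_pi_add_integral_le_le_exp (by linarith) _ hYbound hFconv
    hK hlip (mul_nonneg hδ.le hE0)
  rw [← hmeanF, ← hYlaw, map_measureReal_apply hYvec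
    (measurableSet_le measurable_const hFcont.measurable)] at hconc
  refine (measureReal_mono fun ω hω => ?_).trans (hconc.trans_eq ?_)
  · simp only [Set.mem_preimage, Set.mem_ofPred_eq, ← hFX] at hω ⊢
    linarith
  · congr 1
    rw [mul_pow, show |D| / 2 - -(|D| / 2) = |D| by ring, sq_abs, ← mul_assoc]
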